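/- Let $\Lambda^-=\mathbb C[p_1,p_3,p_5,\dots]$ be the ring generated by the odd power sums, and define operators $Y_n$ ($n\in\mathbb Z$) on $\Lambda^-$ by $$Y(t)=\sum_{n\in\mathbb Z}Y_nt^{-n}=\exp\Big(\sum_{k\ge1}\frac{2t^{2k-1}}{2k-1}p_{2k-1}\Big)\exp\Big(-\sum_{k\ge1}t^{-(2k-1)}\frac{\partial}{\partial p_{2k-1}}\Big).$$ For a composition $\mu=(\mu_1,\dots,\mu_l)$, that is, a finite sequence of integers, put $Y_{-\mu}=Y_{-\mu_1}Y_{-\mu_2}\cdots Y_{-\mu_l}$. The code of $\mu$ is the doubly infinite word (up to translation) in the letters $R,L,U$ (unit steps right, left and up) that traces the path going up along the negative $y$-axis, then through the rows from the bottom row $\mu_l$ to the top row $\mu_1$ (in the row of $\mu_i$: horizontally to abscissa $\mu_i$ along the lower edge, without backtracking, then one step up), then right along the $x$-axis forever. An arbitrary word is the code of a composition $\nu$ if it becomes the word just described after finitely many cancellations of adjacent letters $LR$ or $RL$. Let $\mu$ be a composition of $m$ (that is, $\sum_i\mu_i=m$) whose code $\alpha$, in which all cancellations have been made, can be written as $$\alpha=\dots\beta_3\beta_2\beta_1L^kU\gamma_1\gamma_2\gamma_3\dots,\qquad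 k\ge 0,$$ where all $\beta_i\in\{R,U\}$ and $\beta_1=U$. Suppose that $\beta_{k+j}\dots\beta_2\beta_1$ contains exactly $k$ letters $R$ for some $j\ge0$, and let $j$ be the smallest such integer. (1) If $\beta_{k+j+1}=U$ and $\beta_i=R$ for some $i>k+j+1$ (which is automatic if $k\ge1$ and all components of $\mu$ are positive), then $Y_{-\mu}=0$. (2) If $\beta_{k+j+1}=R$, then there is exactly one composition $\nu$ with the same number of components as $\mu$ and with code $$\dots\beta_{k+j+2}\,\beta_{k+j+1}\,U\,\beta_{k+j}\dots\beta_2\beta_1L^k\gamma_1\gamma_2\gamma_3\dots ;$$ it is a composition of $m$, its components are positive if those of $\mu$ are, and $Y_{-\mu}=(-1)^jY_{-\nu}$. -/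

import Mathlib

namespace QCode

/-! ### The operators `Y_n` on the ring generated by the odd power sums -/

/-- The ring `ℂ[p₁, p₃, p₅, …]` of polynomials in the odd power sums;
the variable with index `i` is the power sum `p_{2i+1}`. -/
abbrev OddSym : Type := MvPolynomial ℕ ℂ

/-- The odd power sum `p_n` for odd `n`. -/
noncomputable def powerSum (n : ℕ) : OddSym := MvPolynomial.X (n / 2)

/-- The derivative `∂/∂p_n` for odd `n`. -/
noncomputable def dPowerSum (n : ℕ) : Module.End ℂ OddSym :=
  (MvPolynomial.pderiv (R := ℂ) (n / 2) : OddSym →ₗ[ℂ] OddSym)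

/-- The coefficient of degree `n` of `exp g = ∑ᵣ gʳ / r!`, for a power series `g` without constant
term over a (not necessarily commutative) algebra `A`. As `g` has no constant term, only the powers
`gʳ` with `r ≤ n` contribute. -/
noncomputable def expCoeff {A : Type*} [Ring A] [Algebra ℂ A] (g : PowerSeries A) (n : ℕ) : A :=
  ∑ r ∈ Finset.range (n + 1), ((r.factorial : ℂ)⁻¹) • PowerSeries.coeff n (g ^ r)

/-- The series `∑_{n odd} (2 / n) p_n tⁿ` of multiplication operators, in the variable `t`. -/
noncomputable def raisingSeries : PowerSeries (Module.End ℂ OddSym) :=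
  PowerSeries.mk fun n =>
    if Odd n then (2 / (n : ℂ)) • LinearMap.mulLeft ℂ (powerSum n) else 0

/-- The series `- ∑_{n odd} t⁻ⁿ ∂/∂p_n` of operators, in the variable `t⁻¹`. -/
noncomputable def loweringSeries : PowerSeries (Module.End ℂ OddSym) :=
  PowerSeries.mk fun n => if Odd n then -dPowerSum n else 0

/-- The coefficient of `tᵃ` in `exp (∑_{n odd} (2 / n) p_n tⁿ)`. -/
noncomputable def raising (a : ℕ) : Module.End ℂ OddSym := expCoeff raisingSeries a

/-- The coefficient of `t⁻ᵇ` in `exp (- ∑_{n odd} t⁻ⁿ ∂/∂p_n)`. -/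
noncomputable def lowering (b : ℕ) : Module.End ℂ OddSym := expCoeff loweringSeries b

/-- The weight of a monomial, where `p_{2i+1}` has weight `2i+1`. -/
def wt (m : ℕ →₀ ℕ) : ℕ := m.sum fun i e => e * (2 * i + 1)

/-- Polynomials all of whose monomials have weight at most the integer `N`. -/
def wtLE (N : ℤ) : Submodule ℂ OddSym where
  carrier := {f | ∀ m ∈ f.support, (wt m : ℤ) ≤ N}
  zero_mem' := by simp
  add_mem' := by
    intro f g hf hg m hm
    rcases Finset.mem_union.1 (MvPolynomial.support_add hm) with h | h
    · exact hf m h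
    · exact hg m h
  smul_mem' := by
    intro c f hf m hm
    exact hf m (MvPolynomial.support_smul hm)

theorem wt_single_add (i : ℕ) (m : ℕ →₀ ℕ) :
    wt (Finsupp.single i 1 + m) = (2 * i + 1) + wt m := by
  unfold wt
  rw [Finsupp.sum_add_index' (by simp) (by intros; ring)]
  simp

theorem dPowerSum_mem {n : ℕ} (hn : Odd n) {N : ℤ} {f : OddSym} (hf : f ∈ wtLE N) :
    dPowerSum n f ∈ wtLE (N - n) := by
  obtain ⟨i, rfl⟩ := hn
  intro m hm
  have hi : (2 * i + 1) / 2 = i := by omega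
  have hm' : MvPolynomial.coeff m (MvPolynomial.pderiv i f) ≠ 0 := by
    have := MvPolynomial.mem_support_iff.1 hm
    simpa [dPowerSum, hi] using this
  have key : MvPolynomial.coeff (m + Finsupp.single i 1) f ≠ 0 := by
    intro h0
    apply hm'
    rw [MvPolynomial.coeff_pderiv, h0, zero_mul]
  have := hf _ (MvPolynomial.mem_support_iff.2 key)
  rw [add_comm, wt_single_add] at this
  push_cast at this ⊢
  linarith

theorem coeff_loweringSeries_mem (n : ℕ) {N : ℤ} {f : OddSym} (hf : f ∈ wtLE N) :
    PowerSeries.coeff n loweringSeries f ∈ wtLE (N - n) := by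
  unfold loweringSeries
  rw [PowerSeries.coeff_mk]
  split_ifs with h
  · simpa using (wtLE (N - n)).neg_mem (dPowerSum_mem h hf)
  · simp

theorem coeff_loweringSeries_pow_mem (r n : ℕ) {N : ℤ} {f : OddSym} (hf : f ∈ wtLE N) :
    PowerSeries.coeff n (loweringSeries ^ r) f ∈ wtLE (N - n) := by
  induction r generalizing n N f with
  | zero =>
    rw [pow_zero, PowerSeries.coeff_one]
    split_ifs with h
    · subst h; simpa using hf
    · simp
  | succ r ih =>
    rw [pow_succ, PowerSeries.coeff_mul, LinearMap.sum_apply]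
    refine Submodule.sum_mem _ fun p hp => ?_
    have h1 := ih p.1 (coeff_loweringSeries_mem p.2 hf)
    have h2 : p.1 + p.2 = n := Finset.HasAntidiagonal.mem_antidiagonal.1 hp
    have h3 : N - p.2 - p.1 = N - n := by rw [← h2]; push_cast; ring
    rw [h3] at h1
    exact h1

theorem lowering_mem (b : ℕ) {N : ℤ} {f : OddSym} (hf : f ∈ wtLE N) :
    lowering b f ∈ wtLE (N - b) := by
  unfold lowering expCoeff
  rw [LinearMap.sum_apply]
  exact Submodule.sum_mem _ fun r _ =>
    Submodule.smul_mem _ _ (coeff_loweringSeries_pow_mem r b hf)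

theorem eq_zero_of_mem_wtLE {N : ℤ} (hN : N < 0) {f : OddSym} (hf : f ∈ wtLE N) : f = 0 := by
  by_contra h
  obtain ⟨m, hm⟩ := Finset.nonempty_of_ne_empty (fun h' => h (MvPolynomial.support_eq_empty.1 h'))
  have := hf m hm
  omega

/-- On every polynomial, only finitely many of the operators `lowering b` are nonzero. -/
theorem lowering_locally_finite (f : OddSym) : ∃ N : ℕ, ∀ b, N < b → lowering b f = 0 := by
  refine ⟨f.support.sup wt, fun b hb => ?_⟩
  have hf : f ∈ wtLE (f.support.sup wt : ℕ) := by
    intro m hm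
    exact_mod_cast Finset.le_sup (f := wt) hm
  exact eq_zero_of_mem_wtLE (by omega) (lowering_mem b hf)

/-- The `b`-th summand of the coefficient of `t⁻ⁿ` in the product of the two exponentials. -/
noncomputable def YTerm (n : ℤ) (b : ℕ) : Module.End ℂ OddSym :=
  if n ≤ b then raising (b - n).toNat * lowering b else 0

theorem YTerm_support_finite (n : ℤ) (f : OddSym) :
    (Function.support fun b : ℕ => YTerm n b f).Finite := by
  obtain ⟨N, hN⟩ := lowering_locally_finite f
  refine (Set.finite_Iic N).subset fun b hb => ?_
  by_contra h
  apply hb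
  have h0 := hN b (not_le.1 h)
  by_cases hn : n ≤ b <;> simp [YTerm, hn, h0]

/-- The operator `Y_n`, the coefficient of `t⁻ⁿ` in
`Y(t) = exp (∑_{n odd} (2 / n) p_n tⁿ) exp (- ∑_{n odd} t⁻ⁿ ∂/∂p_n) = ∑_n Y_n t⁻ⁿ`.
On every polynomial the sum over `b` is finite. -/
noncomputable def Y (n : ℤ) : Module.End ℂ OddSym where
  toFun f := ∑ᶠ b : ℕ, YTerm n b f
  map_add' f g := by
    simp only [map_add]
    exact finsum_add_distrib (YTerm_support_finite n f) (YTerm_support_finite n g)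
  map_smul' c f := by
    simp only [map_smul, RingHom.id_apply]
    exact (smul_finsum' c (YTerm_support_finite n f)).symm

/-- `Y_{-μ} = Y_{-μ₁} Y_{-μ₂} ⋯ Y_{-μ_l}`. -/
noncomputable def YNeg (μ : List ℤ) : Module.End ℂ OddSym := (μ.map fun a => Y (-a)).prod

/-! ### Codes -/

/-- Unit steps to the right, to the left, and up. -/
inductive Letter
  | R
  | L
  | U
  deriving DecidableEq

open Letter

/-- The doubly infinite word `… β₂ β₁ w γ₁ γ₂ …`, where `w` is a finite word,
`βᵢ` is `β (i - 1)` and `γᵢ` is `γ (i - 1)`. -/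
def splice (β : ℕ → Letter) (w : List Letter) (γ : ℕ → Letter) : ℤ → Letter := fun i =>
  if i < 0 then β (-i - 1).toNat
  else w.getD i.toNat (γ (i.toNat - w.length))

/-- Doubly infinite words are regarded up to a shift of the positions. -/
def SameWord (a b : ℤ → Letter) : Prop := ∃ s : ℤ, ∀ i, a (i + s) = b i

/-- The horizontal steps from abscissa `x` to abscissa `y`. -/
def steps (x y : ℤ) : List Letter :=
  List.replicate (y - x).toNat R ++ List.replicate (x - y).toNat L

/-- The part of the path along the rows of a diagram, from the bottom row (the last component) to
the top row (the first component): in each row go horizontally from the end of the row below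
(abscissa `0` for the bottom row) to the end of this row, then one step up. -/
def rowsWord : List ℤ → List Letter
  | [] => []
  | a :: rest => rowsWord rest ++ steps (rest.headD 0) a ++ [U]

/-- The code of a composition: up along the negative `y`-axis, along the rows,
and right along the `x`-axis. -/
def code (μ : List ℤ) : ℤ → Letter := splice (fun _ => U) (rowsWord μ) (fun _ => R)

/-- `b` arises from `a` by cancelling two adjacent letters `LR` or `RL`. -/
def Cancel (a b : ℤ → Letter) : Prop :=
  ∃ (β : ℕ → Letter) (c : List Letter) (γ : ℕ → Letter), (c = [L, R] ∨ c = [R, L]) ∧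
    SameWord a (splice β c γ) ∧ SameWord b (splice β [] γ)

/-- The word `a` becomes the code of `μ` after finitely many cancellations (possibly none). -/
def HasCode (μ : List ℤ) (a : ℤ → Letter) : Prop :=
  ∃ b, Relation.ReflTransGen Cancel a b ∧ SameWord b (code μ)

/-- The number of letters `R` in `βₙ ⋯ β₂ β₁`. -/
def countR (β : ℕ → Letter) (n : ℕ) : ℕ := ((Finset.range n).filter fun i => β i = R).card

/-- The word `… β_{n+2} β_{n+1} U βₙ ⋯ β₂ β₁ Lᵏ γ₁ γ₂ …`. -/
def insertedWord (β : ℕ → Letter) (k n : ℕ) (γ : ℕ → Letter) : ℤ → Letter :=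
  splice (fun i => β (n + i))
    (U :: ((List.range n).map β).reverse ++ List.replicate k L) γ

end QCode

/-! The abscissae of the steps up in the code of `μ`, read from the end, are the components of `μ`
followed by zeros from the negative y-axis. Cancelling `LR` or `RL` does not change them. If
`β_{k+j} ⋯ β_1` contains exactly `k` letters `R`, its displacement is undone by `L^k`, so the step
`U` after `L^k` has the same abscissa `x` as the point just before `β_{k+j}`. Moving this `U` in
front of `β_{k+j}` therefore moves the component `x` past the `j` components given by the letters
`U` of `β_{k+j} ⋯ β_1`, and alters no component. If some `R` stands further left then `x > 0`, and
the components passed are at least `x`.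

Everything thus follows from `Y_neg_mul_Y_neg`: the operators `Y (-a)`, `a > 0`, anticommute and
hence have square zero. The move costs `(-1)^j`; if `β_{k+j+1} = U`, the next component is again `x`
and the product vanishes.

For the anticommutation let `Q(t)` and `D(t)` be the two exponentials in `Y(t)`. Normal ordering of
`D(s) Q(t)` produces the factor `(1 - t/s)/(1 + t/s)` (`lowering_mul_raisingZ`), so `Y(s) Y(t)`
equals this factor times `Q(s) Q(t) D(s) D(t)`. As a rational function the factor is antisymmetric.
The expansions in `t/s` and in `s/t` differ by a delta function at `s = -t`, where `Q(t) Q(-t) = 1`,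
so only the constant coefficient is affected (`crossSum_add_crossSum_swap`). The exponential
identities are proved by uniqueness for the equation `t f' = g f`.

On the combinatorial side, `exists_rows` locates the moved row, `hasCode_splice` gives existence of
`ν`, and `HasCode.getD_eq` gives uniqueness. -/

namespace QCode

open PowerSeries Finset

/-! ### The Euler operator on power series over a noncommutative ring -/

section Euler

variable {A : Type*} [Ring A]

/-- The Euler operator `t d/dt` on power series. -/
noncomputable def euler (f : PowerSeries A) : PowerSeries A :=
  PowerSeries.mk fun n => n • PowerSeries.coeff n f

theorem coeff_euler (f : PowerSeries A) (n : ℕ) :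
    PowerSeries.coeff n (euler f) = n • PowerSeries.coeff n f := by
  simp [euler]

theorem euler_mul (f g : PowerSeries A) : euler (f * g) = euler f * g + f * euler g := by
  ext n
  simp only [coeff_euler, map_add, PowerSeries.coeff_mul, Finset.smul_sum,
    ← Finset.sum_add_distrib]
  refine Finset.sum_congr rfl fun p hp => ?_
  rw [← Finset.HasAntidiagonal.mem_antidiagonal.1 hp, add_smul, smul_mul_assoc, mul_smul_comm]

theorem euler_sub (f g : PowerSeries A) : euler (f - g) = euler f - euler g := by
  ext n
  simp [coeff_euler, mul_sub]

theorem euler_C (a : A) : euler (PowerSeries.C a) = 0 := by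
  ext n
  rw [coeff_euler, PowerSeries.coeff_C]
  split_ifs with h <;> simp [h]

theorem euler_one : euler (1 : PowerSeries A) = 0 := by
  simpa using euler_C (1 : A)

theorem commute_of_coeff {f g : PowerSeries A}
    (h : ∀ i j, Commute (PowerSeries.coeff i f) (PowerSeries.coeff j g)) : Commute f g := by
  ext n
  rw [PowerSeries.coeff_mul, PowerSeries.coeff_mul, ← Finset.Nat.sum_antidiagonal_swap]
  exact Finset.sum_congr rfl fun p _ => h p.2 p.1

theorem euler_pow_succ {g : PowerSeries A}
    (hg : ∀ i j, Commute (PowerSeries.coeff i g) (PowerSeries.coeff j g)) (r : ℕ) :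
    euler (g ^ (r + 1)) = (r + 1) • (euler g * g ^ r) := by
  have hc : Commute g (euler g) := commute_of_coeff fun i j => by
    rw [coeff_euler]
    exact (hg i j).smul_right j
  induction r with
  | zero => simp
  | succ r ih =>
    rw [pow_succ' g (r + 1), euler_mul, ih, mul_smul_comm, ← mul_assoc, hc.eq, mul_assoc,
      ← pow_succ', add_smul (r + 1) 1, one_smul, add_comm]

/-- Since `g` has no constant term, the equation expresses `n` times the `n`-th coefficient of `f`
through lower ones. Identities between series follow by applying this to the difference of the two
sides. -/
theorem eq_zero_of_euler_eq_mul [Algebra ℂ A] {f g : PowerSeries A}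
    (hg : PowerSeries.coeff 0 g = 0) (hf : PowerSeries.coeff 0 f = 0)
    (h : euler f = g * f) : f = 0 := by
  ext n
  induction n using Nat.strong_induction_on with
  | _ n ih =>
    rcases Nat.eq_zero_or_pos n with rfl | hn
    · simpa using hf
    have h1 : n • PowerSeries.coeff n f = 0 := by
      rw [← coeff_euler, h, PowerSeries.coeff_mul]
      refine Finset.sum_eq_zero fun p hp => ?_
      have hp' := Finset.HasAntidiagonal.mem_antidiagonal.1 hp
      rcases Nat.eq_zero_or_pos p.1 with h0 | h0
      · rw [h0, hg, zero_mul]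
      · rw [ih p.2 (by omega), map_zero, mul_zero]
    rw [map_zero]
    rw [← Nat.cast_smul_eq_nsmul ℂ] at h1
    exact (smul_eq_zero.1 h1).resolve_left (by exact_mod_cast hn.ne')

theorem coeff_pow_eq_zero {g : PowerSeries A} (hg : PowerSeries.coeff 0 g = 0) {n r : ℕ}
    (h : n < r) : PowerSeries.coeff n (g ^ r) = 0 := by
  induction r generalizing n with
  | zero => omega
  | succ r ih =>
    rw [pow_succ', PowerSeries.coeff_mul]
    refine Finset.sum_eq_zero fun p hp => ?_
    have hp' := Finset.HasAntidiagonal.mem_antidiagonal.1 hp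
    rcases Nat.eq_zero_or_pos p.1 with h0 | h0
    · rw [h0, hg, zero_mul]
    · rw [ih (by omega), mul_zero]

theorem coeff_zero_mul (f g : PowerSeries A) : PowerSeries.coeff 0 (f * g) =
    PowerSeries.coeff 0 f * PowerSeries.coeff 0 g := by
  rw [PowerSeries.coeff_mul, Finset.Nat.antidiagonal_zero, Finset.sum_singleton]

theorem commutator_sub_mul_left {d G R T T' : A} (h : d * G = G * d + T') (hT : T * G = G * T) :
    d * (G * R) - G * R * d - (T' * R + T * (G * R)) = G * (d * R - R * d - T * R) := by
  rw [← mul_assoc, h, ← mul_assoc T, hT]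
  noncomm_ring

theorem intertwiner_sub_mul_left (D G K q : A) :
    G * D * q - ((G * K - K * G) * D + K * (G * D)) = G * (D * q - K * D) := by
  noncomm_ring

variable [Algebra ℂ A]

/-- The exponential of a power series without constant term. -/
noncomputable def expSeries (g : PowerSeries A) : PowerSeries A := PowerSeries.mk (expCoeff g)

theorem coeff_expSeries (g : PowerSeries A) (n : ℕ) :
    PowerSeries.coeff n (expSeries g) = expCoeff g n := by
  simp [expSeries]

theorem expCoeff_zero (g : PowerSeries A) : expCoeff g 0 = 1 := by
  simp [expCoeff]

theorem euler_expSeries {g : PowerSeries A} (hg0 : PowerSeries.coeff 0 g = 0)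
    (hg : ∀ i j, Commute (PowerSeries.coeff i g) (PowerSeries.coeff j g)) :
    euler (expSeries g) = euler g * expSeries g := by
  ext n
  rw [coeff_euler, coeff_expSeries, expCoeff, Finset.smul_sum, Finset.sum_range_succ']
  simp only [smul_comm n, ← coeff_euler, pow_zero, euler_one, map_zero, smul_zero, add_zero]
  have h1 : ∀ r ∈ Finset.range n,
      (((r + 1).factorial : ℂ)⁻¹) • PowerSeries.coeff n (euler (g ^ (r + 1))) =
        ∑ p ∈ antidiagonal n, PowerSeries.coeff p.1 (euler g) *
          ((r.factorial : ℂ)⁻¹ • PowerSeries.coeff p.2 (g ^ r)) := by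
    intro r _
    rw [euler_pow_succ hg, map_nsmul, ← Nat.cast_smul_eq_nsmul ℂ, smul_smul, Nat.factorial_succ,
      PowerSeries.coeff_mul, Finset.smul_sum]
    refine Finset.sum_congr rfl fun p _ => ?_
    rw [mul_smul_comm]
    congr 1
    have : (r.factorial : ℂ) ≠ 0 := by exact_mod_cast r.factorial_ne_zero
    have : (r : ℂ) + 1 ≠ 0 := by exact_mod_cast r.succ_ne_zero
    push_cast
    field_simp
  rw [Finset.sum_congr rfl h1, Finset.sum_comm, PowerSeries.coeff_mul]
  refine Finset.sum_congr rfl fun p hp => ?_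
  have hp' := Finset.HasAntidiagonal.mem_antidiagonal.1 hp
  rw [← Finset.mul_sum, coeff_expSeries, expCoeff]
  rcases Nat.eq_zero_or_pos p.1 with h0 | h0
  · rw [h0, coeff_euler, zero_smul, zero_mul, zero_mul]
  · congr 1
    symm
    -- The two truncations of the exponential differ only in powers `g ^ r` with `r > p.2`, which do
    -- not reach degree `p.2`.
    refine Finset.sum_subset (by intro r; simp only [Finset.mem_range]; omega) fun r _ hr => ?_
    rw [coeff_pow_eq_zero hg0 (by simpa using hr), smul_zero]

theorem commute_expCoeff {g : PowerSeries A} {a : A}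
    (h : ∀ i, Commute a (PowerSeries.coeff i g)) (n : ℕ) : Commute a (expCoeff g n) := by
  have h1 : Commute (PowerSeries.C a) g := by
    ext n
    rw [PowerSeries.coeff_C_mul, PowerSeries.coeff_mul_C]
    exact h n
  refine Commute.sum_right _ _ _ fun r _ => Commute.smul_right ?_ _
  have h2 := congrArg (PowerSeries.coeff n) (h1.pow_right r).eq
  rwa [PowerSeries.coeff_C_mul, PowerSeries.coeff_mul_C] at h2

theorem commute_expCoeff_expCoeff {g : PowerSeries A}
    (hg : ∀ i j, Commute (PowerSeries.coeff i g) (PowerSeries.coeff j g)) (m n : ℕ) :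
    Commute (expCoeff g m) (expCoeff g n) :=
  commute_expCoeff (fun i => (commute_expCoeff (fun j => hg i j) m).symm) n

/-- If `g` is odd then `exp (g(t)) exp (g(-t)) = 1`. -/
theorem sum_neg_one_pow_expCoeff {g : PowerSeries A}
    (hg0 : ∀ n, ¬ Odd n → PowerSeries.coeff n g = 0)
    (hg : ∀ i j, Commute (PowerSeries.coeff i g) (PowerSeries.coeff j g)) {n : ℕ} (hn : 0 < n) :
    ∑ p ∈ antidiagonal n, (-1 : ℂ) ^ p.2 • (expCoeff g p.1 * expCoeff g p.2) = 0 := by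
  have h0 : PowerSeries.coeff 0 g = 0 := hg0 0 (by simp)
  have hE := euler_expSeries h0 hg
  -- This is `exp (g(-t))`; oddness of `g` gives it the logarithmic derivative opposite to that of
  -- `exp g`, so the product is killed by the Euler operator.
  set F : PowerSeries A := PowerSeries.mk fun n => (-1 : ℂ) ^ n • expCoeff g n with hF
  have hEF : euler F = -(euler g * F) := by
    ext n
    have h1 := congrArg (PowerSeries.coeff n) hE
    rw [coeff_euler, coeff_expSeries, PowerSeries.coeff_mul] at h1
    rw [coeff_euler, hF, PowerSeries.coeff_mk, smul_comm, h1, map_neg, PowerSeries.coeff_mul,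
      Finset.smul_sum, ← Finset.sum_neg_distrib]
    refine Finset.sum_congr rfl fun p hp => ?_
    have hp' := Finset.HasAntidiagonal.mem_antidiagonal.1 hp
    rw [PowerSeries.coeff_mk, coeff_expSeries, coeff_euler]
    by_cases ho : Odd p.1
    · rw [← hp', pow_add, ho.neg_one_pow, mul_smul_comm, neg_one_mul, neg_smul]
    · rw [hg0 _ ho]; simp
  have hc : Commute (expSeries g) (euler g) := commute_of_coeff fun i j => by
    rw [coeff_euler, coeff_expSeries]
    exact ((commute_expCoeff (fun i => hg j i) i).symm).smul_right j
  have hz : euler (expSeries g * F) = 0 := by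
    rw [euler_mul, hE, hEF, mul_neg, ← mul_assoc, hc.eq, add_neg_cancel]
  have h2 := congrArg (PowerSeries.coeff n) hz
  rw [coeff_euler, map_zero, ← Nat.cast_smul_eq_nsmul ℂ] at h2
  have h3 := (smul_eq_zero.1 h2).resolve_left (by exact_mod_cast hn.ne')
  rw [PowerSeries.coeff_mul] at h3
  rw [← h3]
  refine Finset.sum_congr rfl fun p _ => ?_
  rw [coeff_expSeries, hF, PowerSeries.coeff_mk, mul_smul_comm]

end Euler

/-! ### Commutation relations between the raising and lowering operators -/

theorem dPowerSum_commute (m n : ℕ) : Commute (dPowerSum m) (dPowerSum n) := by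
  have h : ⁅MvPolynomial.pderiv (R := ℂ) (m / 2), MvPolynomial.pderiv (R := ℂ) (n / 2)⁆ = 0 := by
    refine MvPolynomial.derivation_ext fun i => ?_
    rw [Derivation.commutator_apply]
    simp only [MvPolynomial.pderiv_X, Pi.single_apply, Derivation.coe_zero, Pi.zero_apply]
    split_ifs <;> simp
  refine LinearMap.ext fun f => ?_
  have h1 := DFunLike.congr_fun h f
  rw [Derivation.commutator_apply] at h1
  exact sub_eq_zero.1 h1

theorem dPowerSum_mul_mulLeft {m n : ℕ} (hm : Odd m) (hn : Odd n) :
    dPowerSum m * LinearMap.mulLeft ℂ (powerSum n) =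
      LinearMap.mulLeft ℂ (powerSum n) * dPowerSum m + if m = n then 1 else 0 := by
  refine LinearMap.ext fun f => ?_
  have h1 : MvPolynomial.pderiv (R := ℂ) (m / 2) (MvPolynomial.X (n / 2) : OddSym) =
      if m = n then 1 else 0 := by
    rw [MvPolynomial.pderiv_X, Pi.single_apply]
    obtain ⟨a, rfl⟩ := hm
    obtain ⟨b, rfl⟩ := hn
    congr 1
    rw [eq_iff_iff]
    omega
  simp only [Module.End.mul_apply, LinearMap.add_apply, LinearMap.mulLeft_apply, powerSum,
    dPowerSum, Derivation.coeFn_coe, Derivation.leibniz, h1, smul_eq_mul]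
  split_ifs <;> simp

theorem coeff_raisingSeries_commute (i j : ℕ) :
    Commute (PowerSeries.coeff i raisingSeries) (PowerSeries.coeff j raisingSeries) := by
  have h (p q : OddSym) : Commute (LinearMap.mulLeft ℂ p) (LinearMap.mulLeft ℂ q) := by
    refine LinearMap.ext fun f => ?_
    simp only [Module.End.mul_apply, LinearMap.mulLeft_apply]
    ring
  simp only [raisingSeries, PowerSeries.coeff_mk]
  split_ifs
  · exact ((h _ _).smul_right _).smul_left _
  all_goals simp

theorem coeff_raisingSeries_of_not_odd {n : ℕ} (hn : ¬ Odd n) :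
    PowerSeries.coeff n raisingSeries = 0 := by
  simp [raisingSeries, hn]

theorem coeff_loweringSeries_commute (i j : ℕ) :
    Commute (PowerSeries.coeff i loweringSeries) (PowerSeries.coeff j loweringSeries) := by
  simp only [loweringSeries, PowerSeries.coeff_mk]
  split_ifs
  · exact ((dPowerSum_commute i j).neg_left).neg_right
  all_goals simp

theorem lowering_commute (m n : ℕ) : Commute (lowering m) (lowering n) :=
  commute_expCoeff_expCoeff coeff_loweringSeries_commute m n

theorem raising_commute (m n : ℕ) : Commute (raising m) (raising n) :=
  commute_expCoeff_expCoeff coeff_raisingSeries_commute m n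

/-- The operators `raising a`, extended by zero to negative indices. -/
noncomputable def raisingZ (a : ℤ) : Module.End ℂ OddSym := if 0 ≤ a then raising a.toNat else 0

theorem raisingZ_of_neg {a : ℤ} (h : a < 0) : raisingZ a = 0 := if_neg (by omega)

theorem raisingZ_natCast (a : ℕ) : raisingZ a = raising a := by simp [raisingZ]

/-- The commutator of `∂/∂p_n` with the exponent is the scalar `(2/n) tⁿ`, so its commutator with
the exponential `R` is `(2/n) tⁿ R`. Both sides of the latter satisfy the same first-order equation.
-/
theorem dPowerSum_mul_raisingZ {n : ℕ} (hn : Odd n) (a : ℤ) :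
    dPowerSum n * raisingZ a =
      raisingZ a * dPowerSum n + (2 / (n : ℂ)) • raisingZ (a - n) := by
  rcases lt_or_ge a 0 with ha | ha
  · rw [raisingZ_of_neg ha, raisingZ_of_neg (by omega)]; simp
  lift a to ℕ using ha
  set R : PowerSeries (Module.End ℂ OddSym) := expSeries raisingSeries with hR
  set d : PowerSeries (Module.End ℂ OddSym) := PowerSeries.C (dPowerSum n) with hd
  set T : PowerSeries (Module.End ℂ OddSym) := PowerSeries.C ((2 / (n : ℂ)) • 1) *
    PowerSeries.X ^ n with hT
  have h0 : PowerSeries.coeff 0 raisingSeries = 0 := coeff_raisingSeries_of_not_odd (by simp)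
  have hE : euler R = euler raisingSeries * R := euler_expSeries h0 coeff_raisingSeries_commute
  have hTcoeff (i : ℕ) : PowerSeries.coeff i T = if i = n then (2 / (n : ℂ)) • 1 else 0 := by
    rw [hT, PowerSeries.coeff_C_mul, PowerSeries.coeff_X_pow]
    split_ifs <;> simp
  have hTc (f : PowerSeries (Module.End ℂ OddSym)) : T * f = f * T := by
    refine (commute_of_coeff fun i j => ?_ : Commute T f)
    rw [hTcoeff]
    split_ifs
    · exact (Commute.one_left _).smul_left _
    · exact Commute.zero_left _
  have hdG : d * euler raisingSeries = euler raisingSeries * d + euler T := by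
    ext1 i
    rw [map_add, hd, PowerSeries.coeff_C_mul, PowerSeries.coeff_mul_C, coeff_euler, coeff_euler,
      hTcoeff, raisingSeries, PowerSeries.coeff_mk]
    split_ifs with h1 h2 h2
    · rw [mul_smul_comm, mul_smul_comm, dPowerSum_mul_mulLeft hn h1, if_pos h2.symm]
      simp [smul_add, mul_assoc, h2]
    · rw [mul_smul_comm, mul_smul_comm, dPowerSum_mul_mulLeft hn h1, if_neg (Ne.symm h2)]
      simp [mul_assoc]
    · exact absurd (h2 ▸ hn) h1
    · simp
  have hZ : d * R - R * d - T * R = 0 := by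
    refine eq_zero_of_euler_eq_mul (g := euler raisingSeries) (by simp [coeff_euler]) ?_ ?_
    · have hn0 : 0 ≠ n := fun h => by simp [← h] at hn
      rw [map_sub, map_sub, coeff_zero_mul, coeff_zero_mul, coeff_zero_mul, hTcoeff, if_neg hn0,
        hR, coeff_expSeries, expCoeff_zero, mul_one, one_mul, zero_mul, sub_self, sub_zero]
    · rw [euler_sub, euler_sub, euler_mul, euler_mul, euler_mul, hE, hd, euler_C, ← hd, zero_mul,
        mul_zero, zero_add, add_zero]
      exact commutator_sub_mul_left hdG (hTc _)
  have h1 := congrArg (PowerSeries.coeff a) hZ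
  rw [map_sub, map_sub, map_zero, hd, PowerSeries.coeff_C_mul, PowerSeries.coeff_mul_C, hT,
    mul_assoc, PowerSeries.coeff_C_mul, hR, PowerSeries.coeff_X_pow_mul', coeff_expSeries,
    sub_sub, sub_eq_zero] at h1
  rw [raisingZ_natCast]
  refine h1.trans ?_
  congr 1
  split_ifs with h2
  · rw [← Nat.cast_sub h2, raisingZ_natCast, smul_mul_assoc, one_mul, coeff_expSeries]; rfl
  · rw [raisingZ_of_neg (by omega)]; simp

/-- The coefficients of `(1 - u) / (1 + u)`. -/
noncomputable def crossCoeff (i : ℕ) : ℂ := if i = 0 then 1 else 2 * (-1) ^ i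

/-- This is the differential equation of `(1 - u)/(1 + u) = exp (-2 ∑_{n odd} uⁿ/n)`. Splitting off
the first two terms of the sum for `i + 2` leaves the sum for `i`. -/
theorem natCast_mul_crossCoeff (i : ℕ) :
    (i : ℂ) * crossCoeff i =
      -∑ p ∈ antidiagonal i, if Odd p.1 then 2 * crossCoeff p.2 else 0 := by
  induction i using Nat.strong_induction_on with
  | _ i ih =>
    match i with
    | 0 => simp
    | 1 =>
      rw [Finset.Nat.sum_antidiagonal_succ]
      simp [crossCoeff]
    | i + 2 =>
      have h := ih i (by omega)
      rw [Finset.Nat.sum_antidiagonal_succ, Finset.Nat.sum_antidiagonal_succ]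
      have h2 (k : ℕ) : Odd (k + 1 + 1) ↔ Odd k := by
        simp [Nat.odd_add_one]
      simp only [h2, Nat.not_odd_zero, if_false, zero_add, odd_one, if_true]
      rw [neg_add, ← h]
      rcases Nat.eq_zero_or_pos i with rfl | hi
      · simp [crossCoeff]
      · simp only [crossCoeff, hi.ne', if_false, Nat.succ_ne_zero]
        push_cast
        ring

theorem lowering_mul_raisingZ (b : ℕ) (a : ℤ) :
    lowering b * raisingZ a =
      ∑ p ∈ antidiagonal b, crossCoeff p.1 • (raisingZ (a - p.1) * lowering p.2) := by
  set D : PowerSeries (Module.End ℂ OddSym) := expSeries loweringSeries with hD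
  set G : PowerSeries (Module.End ℂ OddSym) := euler loweringSeries with hG
  set K : PowerSeries (Module.End ℂ OddSym) :=
    PowerSeries.mk fun i => crossCoeff i • raisingZ (a - i) with hK
  have h0 : PowerSeries.coeff 0 loweringSeries = 0 := by simp [loweringSeries]
  have hE : euler D = G * D := euler_expSeries h0 coeff_loweringSeries_commute
  -- Commuting `G` past `raisingZ` gives the scalars `-2` in odd degrees, so this is the
  -- differential equation of `crossCoeff`. Consequently `K * D` satisfies the same equation as `D`
  -- times the constant `raisingZ a`.
  have hEK : euler K = G * K - K * G := by
    ext1 i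
    rw [map_sub, PowerSeries.coeff_mul, PowerSeries.coeff_mul, ← Finset.Nat.sum_antidiagonal_swap
      (f := fun p => PowerSeries.coeff p.1 K * PowerSeries.coeff p.2 G), ← Finset.sum_sub_distrib,
      coeff_euler, hK, PowerSeries.coeff_mk, ← Nat.cast_smul_eq_nsmul ℂ, smul_smul,
      natCast_mul_crossCoeff, neg_smul, Finset.sum_smul, ← Finset.sum_neg_distrib]
    refine Finset.sum_congr rfl fun p hp => ?_
    have hp' := Finset.HasAntidiagonal.mem_antidiagonal.1 hp
    rw [Prod.fst_swap, Prod.snd_swap, hG, coeff_euler, loweringSeries, PowerSeries.coeff_mk,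
      PowerSeries.coeff_mk]
    split_ifs with ho
    · have hne : (p.1 : ℂ) ≠ 0 := by
        have : p.1 ≠ 0 := fun h => by simp [h] at ho
        exact_mod_cast this
      have h1 := dPowerSum_mul_raisingZ ho (a - p.2)
      have h2 : a - p.2 - p.1 = a - i := by rw [← hp']; push_cast; ring
      rw [h2] at h1
      have h3 : -dPowerSum p.1 * raisingZ (a - p.2) = -(dPowerSum p.1 * raisingZ (a - p.2)) :=
        LinearMap.neg_comp _ _
      have h4 : raisingZ (a - p.2) * -dPowerSum p.1 = -(raisingZ (a - p.2) * dPowerSum p.1) :=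
        LinearMap.comp_neg _ _
      rw [← Nat.cast_smul_eq_nsmul ℂ, smul_mul_smul_comm, smul_mul_smul_comm, h3, h4, h1,
        mul_comm (crossCoeff p.2) (p.1 : ℂ), ← smul_sub, neg_sub_neg, sub_add_cancel_left,
        smul_neg, smul_smul]
      congr 2
      field_simp
    · simp
  have hZ : D * PowerSeries.C (raisingZ a) - K * D = 0 := by
    refine eq_zero_of_euler_eq_mul (g := G) (by simp [hG, coeff_euler]) ?_ ?_
    · rw [map_sub, coeff_zero_mul, coeff_zero_mul, hD, coeff_expSeries, expCoeff_zero, hK,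
        PowerSeries.coeff_mk, PowerSeries.coeff_C, if_pos rfl, one_mul, mul_one, crossCoeff,
        if_pos rfl, one_smul, Nat.cast_zero, sub_zero, sub_self]
    · rw [euler_sub, euler_mul, euler_mul, euler_C, hE, hEK, mul_zero, add_zero]
      exact intertwiner_sub_mul_left _ _ _ _
  have h1 := congrArg (PowerSeries.coeff b) hZ
  rw [map_sub, map_zero, PowerSeries.coeff_mul_C, PowerSeries.coeff_mul, sub_eq_zero, hD,
    coeff_expSeries] at h1
  refine h1.trans (Finset.sum_congr rfl fun p _ => ?_)
  rw [coeff_expSeries, hK, PowerSeries.coeff_mk, smul_mul_assoc]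
  rfl


/-! ### Anticommutation of the operators `Y (-a)` with `a > 0` -/

/-- The coefficient of `sᵐ tⁿ` in `Q(s) Q(t) (1 - s⁻¹ t) / (1 + s⁻¹ t)`, where `Q` is the generating
function of the raising operators. -/
noncomputable def crossSum (m n : ℕ) : Module.End ℂ OddSym :=
  ∑ i ∈ range (n + 1), crossCoeff i • (raising (m + i) * raising (n - i))

/-- Multiplication by `1 + s⁻¹ t` clears the denominator. The right-hand side is antisymmetric under
exchanging `m` and `n`, because raising operators commute. -/
theorem crossSum_succ_add (m n : ℕ) :
    crossSum m (n + 1) + crossSum (m + 1) n =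
      raising m * raising (n + 1) - raising (m + 1) * raising n := by
  have h (i : ℕ) : crossCoeff (i + 1) + crossCoeff i = if i = 0 then -1 else 0 := by
    rcases Nat.eq_zero_or_pos i with rfl | hi
    · simp [crossCoeff]; norm_num
    · simp only [crossCoeff, Nat.succ_ne_zero, hi.ne', if_false]; ring
  rw [crossSum, Finset.sum_range_succ', crossSum, add_right_comm, ← Finset.sum_add_distrib]
  have h2 : ∀ i ∈ range (n + 1),
      crossCoeff (i + 1) • (raising (m + (i + 1)) * raising (n + 1 - (i + 1))) +
        crossCoeff i • (raising (m + 1 + i) * raising (n - i)) =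
      if i = 0 then -(raising (m + 1) * raising n) else 0 := by
    intro i _
    rw [add_right_comm m 1 i, ← add_assoc, Nat.add_sub_add_right, ← add_smul, h]
    split_ifs with h0
    · simp [h0]
    · simp
  rw [Finset.sum_congr rfl h2, Finset.sum_ite_eq' (range (n + 1)) 0]
  simp [crossCoeff, sub_eq_neg_add]

/-- By `crossSum_succ_add` the symmetrized sum changes only its sign along a diagonal `m + n =
const`. At the end `n = 0` it is twice a coefficient of `Q(t) Q(-t) = 1` in positive degree. -/
theorem crossSum_add_crossSum_swap {m n : ℕ} (h : 0 < m + n) :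
    crossSum m n + crossSum n m = 0 := by
  induction n generalizing m with
  | zero =>
    have h1 := sum_neg_one_pow_expCoeff (g := raisingSeries)
      (fun n hn => coeff_raisingSeries_of_not_odd hn) coeff_raisingSeries_commute (n := m)
      (by omega)
    rw [← Finset.Nat.sum_antidiagonal_swap, Finset.Nat.sum_antidiagonal_eq_sum_range_succ_mk] at h1
    have h2 : crossSum 0 m + raising 0 * raising m = (2 : ℂ) • ∑ k ∈ range m.succ,
        (-1 : ℂ) ^ k • (raising (m - k) * raising k) := by
      rw [crossSum, Finset.smul_sum, Finset.sum_range_succ', Finset.sum_range_succ', add_assoc]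
      congr 1
      · refine Finset.sum_congr rfl fun i _ => ?_
        rw [smul_smul, crossCoeff, if_neg i.succ_ne_zero, zero_add, (raising_commute _ _).eq]
      · rw [crossCoeff, if_pos rfl, one_smul, pow_zero, one_smul, two_smul, add_zero, Nat.sub_zero,
          (raising_commute _ _).eq]
    have h3 : (2 : ℂ) • ∑ k ∈ range m.succ,
        (-1 : ℂ) ^ k • (raising (m - k) * raising k) = 0 := by
      rw [show ∑ k ∈ range m.succ, (-1 : ℂ) ^ k • (raising (m - k) * raising k) = 0 from h1,
        smul_zero]
    rw [h3] at h2
    rw [← h2, add_comm]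
    congr 1
    rw [crossSum, zero_add, Finset.sum_range_one, crossCoeff, if_pos rfl, one_smul,
      (raising_commute _ _).eq]
    rfl
  | succ n ih =>
    have h1 := crossSum_succ_add m n
    have h2 := crossSum_succ_add n m
    have h3 := ih (m := m + 1) (by omega)
    rw [(raising_commute n (m + 1)).eq, (raising_commute (n + 1) m).eq] at h2
    have h4 : crossSum m (n + 1) + crossSum (n + 1) m =
        (crossSum m (n + 1) + crossSum (m + 1) n) + (crossSum n (m + 1) + crossSum (n + 1) m) -
          (crossSum (m + 1) n + crossSum n (m + 1)) := by abel
    rw [h4, h1, h2, h3]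
    abel

theorem Y_neg_apply (M : ℕ) {f : OddSym} {K : ℕ} (hK : ∀ b, K ≤ b → lowering b f = 0) :
    Y (-M) f = ∑ b ∈ range K, raising (M + b) (lowering b f) := by
  have h (b : ℕ) : YTerm (-M) b f = raising (M + b) (lowering b f) := by
    rw [YTerm, if_pos (by omega), Module.End.mul_apply]
    congr 2
    omega
  change ∑ᶠ b : ℕ, YTerm (-M) b f = _
  simp only [h]
  refine finsum_eq_sum_of_support_subset _ fun b hb => ?_
  by_contra hc
  apply hb
  change raising (M + b) (lowering b f) = 0
  rw [hK b (by simpa using hc), map_zero]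

theorem sum_range_sum_antidiagonal {E : Type*} [AddCommMonoid E] (F : ℕ × ℕ → E) {I J K : ℕ}
    (hK : I + J ≤ K) (hI : ∀ p, I ≤ p.1 → F p = 0) (hJ : ∀ p, J ≤ p.2 → F p = 0) :
    ∑ c ∈ range K, ∑ p ∈ antidiagonal c, F p = ∑ e ∈ range J, ∑ i ∈ range I, F (i, e) := by
  rw [Finset.sum_comm, ← Finset.sum_product', ← Finset.sum_fiberwise_of_maps_to
    (g := fun p : ℕ × ℕ => p.1 + p.2) (t := range K)]
  · refine Finset.sum_congr rfl fun c _ => ?_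
    symm
    refine Finset.sum_subset (fun p hp => ?_) fun p hp hp2 => ?_
    · exact HasAntidiagonal.mem_antidiagonal.2 (Finset.mem_filter.1 hp).2
    · rw [Finset.mem_filter, Finset.mem_product, not_and_or] at hp2
      have h1 := HasAntidiagonal.mem_antidiagonal.1 hp
      rcases hp2 with h | h
      · rw [not_and_or, Finset.mem_range, Finset.mem_range, not_lt, not_lt] at h
        exact h.elim (hI p) (hJ p)
      · exact absurd h1 h
  · intro p hp
    simp only [Finset.mem_product, Finset.mem_range] at hp ⊢
    omega

theorem Y_neg_Y_neg_apply (M N : ℕ) {f : OddSym} {K : ℕ} (hK : ∀ b, K ≤ b → lowering b f = 0) :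
    Y (-M) (Y (-N) f) = ∑ d ∈ range K, ∑ e ∈ range K,
      crossSum (M + e) (N + d) (lowering e (lowering d f)) := by
  obtain ⟨B, hB⟩ := lowering_locally_finite (Y (-N) f)
  -- The cutoff exceeds `B`, beyond which nothing contributes, and is at least `(N + d + 1) + K`, so
  -- that the antidiagonals below it cover the whole box of nonzero terms for every `d < K`.
  rw [Y_neg_apply M (K := B + 1 + (N + K + K)) fun b hb => hB b (by omega), Y_neg_apply N hK]
  simp only [map_sum]
  rw [Finset.sum_comm]
  refine Finset.sum_congr rfl fun d hd => ?_
  rw [Finset.mem_range] at hd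
  set F : ℕ × ℕ → OddSym := fun p => crossCoeff p.1 •
    raising (M + (p.1 + p.2)) (raisingZ ((N + d : ℕ) - p.1) (lowering p.2 (lowering d f))) with hF
  have h1 (c : ℕ) : raising (M + c) (lowering c (raising (N + d) (lowering d f))) =
      ∑ p ∈ antidiagonal c, F p := by
    have h := DFunLike.congr_fun (lowering_mul_raisingZ c (N + d : ℕ)) (lowering d f)
    rw [raisingZ_natCast, Module.End.mul_apply, LinearMap.sum_apply] at h
    rw [h, map_sum]
    refine Finset.sum_congr rfl fun p hp => ?_
    rw [LinearMap.smul_apply, map_smul, Module.End.mul_apply, hF,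
      ← HasAntidiagonal.mem_antidiagonal.1 hp]
  simp only [h1]
  rw [sum_range_sum_antidiagonal F (I := N + d + 1) (J := K) (by omega)]
  · refine Finset.sum_congr rfl fun e _ => ?_
    rw [crossSum, LinearMap.sum_apply]
    refine Finset.sum_congr rfl fun i hi => ?_
    rw [Finset.mem_range] at hi
    rw [hF, LinearMap.smul_apply, Module.End.mul_apply, ← raisingZ_natCast (N + d - i),
      Nat.cast_sub (by omega), add_assoc M e i, add_comm e i]
  · intro p hp
    rw [hF]
    simp only
    rw [raisingZ_of_neg (by omega), LinearMap.zero_apply, map_zero, smul_zero]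
  · intro p hp
    have h2 : lowering p.2 (lowering d f) = 0 := by
      have := DFunLike.congr_fun (lowering_commute p.2 d).eq f
      rw [Module.End.mul_apply, Module.End.mul_apply, hK _ hp, map_zero] at this
      exact this
    rw [hF]
    simp only
    rw [h2, map_zero, map_zero, smul_zero]

theorem Y_neg_mul_Y_neg {a b : ℤ} (ha : 0 < a) (hb : 0 < b) :
    Y (-a) * Y (-b) = -(Y (-b) * Y (-a)) := by
  lift a to ℕ using ha.le
  lift b to ℕ using hb.le
  refine LinearMap.ext fun f => ?_
  obtain ⟨K, hK⟩ := lowering_locally_finite f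
  have hK' : ∀ c, K + 1 ≤ c → lowering c f = 0 := fun c hc => hK c (by omega)
  rw [LinearMap.neg_apply, eq_neg_iff_add_eq_zero, Module.End.mul_apply, Module.End.mul_apply,
    Y_neg_Y_neg_apply a b hK', Y_neg_Y_neg_apply b a hK', Finset.sum_comm,
    ← Finset.sum_add_distrib]
  refine Finset.sum_eq_zero fun d _ => ?_
  rw [← Finset.sum_add_distrib]
  refine Finset.sum_eq_zero fun e _ => ?_
  rw [← Module.End.mul_apply (lowering e), (lowering_commute e d).eq, Module.End.mul_apply,
    ← LinearMap.add_apply, crossSum_add_crossSum_swap (by omega), LinearMap.zero_apply]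

theorem Y_neg_mul_self {a : ℤ} (ha : 0 < a) : Y (-a) * Y (-a) = 0 := by
  have h := Y_neg_mul_Y_neg ha ha
  refine LinearMap.ext fun f => ?_
  have h1 := DFunLike.congr_fun h f
  exact self_eq_neg.1 h1

/-! ### Reordering positive factors of `YNeg` -/

theorem YNeg_append (l₁ l₂ : List ℤ) : YNeg (l₁ ++ l₂) = YNeg l₁ * YNeg l₂ := by
  simp [YNeg]

theorem YNeg_cons (a : ℤ) (l : List ℤ) : YNeg (a :: l) = Y (-a) * YNeg l := by
  simp [YNeg]

theorem YNeg_cons_eq {x : ℤ} (hx : 0 < x) {A : List ℤ} (hA : ∀ a ∈ A, 0 < a) (C : List ℤ) :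
    YNeg (x :: (A ++ C)) = (-1 : ℂ) ^ A.length • YNeg (A ++ x :: C) := by
  induction A with
  | nil => simp
  | cons a A ih =>
    have ih' := ih fun b hb => hA b (List.mem_cons_of_mem _ hb)
    rw [List.cons_append, YNeg_cons, YNeg_cons, ← mul_assoc,
      Y_neg_mul_Y_neg hx (hA a List.mem_cons_self)]
    have h1 : -(Y (-a) * Y (-x)) * YNeg (A ++ C) = -(Y (-a) * (Y (-x) * YNeg (A ++ C))) :=
      LinearMap.neg_comp _ _
    rw [h1, ← YNeg_cons x, ih', mul_smul_comm, List.cons_append, YNeg_cons a, List.length_cons,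
      pow_succ, mul_neg_one]
    exact (neg_smul _ _).symm

theorem YNeg_move {x : ℤ} (hx : 0 < x) (G : List ℤ) {A : List ℤ} (hA : ∀ a ∈ A, 0 < a)
    (C : List ℤ) :
    YNeg (G ++ x :: (A ++ C)) = (-1 : ℂ) ^ A.length • YNeg (G ++ (A ++ x :: C)) := by
  rw [YNeg_append, YNeg_cons_eq hx hA, YNeg_append G, mul_smul_comm]

theorem YNeg_eq_zero_of_repeated {x : ℤ} (hx : 0 < x) (G : List ℤ) {A : List ℤ}
    (hA : ∀ a ∈ A, 0 < a) (C : List ℤ) : YNeg (G ++ x :: (A ++ x :: C)) = 0 := by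
  rw [YNeg_move hx G hA, YNeg_append, YNeg_append, YNeg_cons, YNeg_cons, ← mul_assoc (Y (-x)),
    Y_neg_mul_self hx]
  simp

end QCode

namespace QCode

open Letter

/-! ### Abscissae of the steps up -/

/-- The horizontal displacement of a letter. -/
def Letter.dx : Letter → ℤ
  | R => 1
  | L => -1
  | U => 0

/-- The horizontal displacement of a finite word. -/
def disp (w : List Letter) : ℤ := (w.map Letter.dx).sum

/-- The abscissae of the steps up of a path with starting abscissa `x`, from the last to the
first. -/
def profile : ℤ → List Letter → List ℤ
  | _, [] => []
  | x, R :: w => profile (x + 1) w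
  | x, L :: w => profile (x - 1) w
  | x, U :: w => profile x w ++ [x]

theorem disp_append (w v : List Letter) : disp (w ++ v) = disp w + disp v := by
  simp [disp]

theorem profile_append (x : ℤ) (w v : List Letter) :
    profile x (w ++ v) = profile (x + disp w) v ++ profile x w := by
  induction w generalizing x with
  | nil => simp [profile, disp]
  | cons c w ih =>
    cases c <;> simp [profile, ih, disp, Letter.dx, add_assoc, sub_eq_add_neg]

theorem profile_replicate_R (x : ℤ) (n : ℕ) : profile x (List.replicate n R) = [] := by
  induction n generalizing x with
  | zero => rfl
  | succ n ih => rw [List.replicate_succ, profile, ih]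

theorem profile_replicate_L (x : ℤ) (n : ℕ) : profile x (List.replicate n L) = [] := by
  induction n generalizing x with
  | zero => rfl
  | succ n ih => rw [List.replicate_succ, profile, ih]

theorem profile_replicate_U (x : ℤ) (n : ℕ) :
    profile x (List.replicate n U) = List.replicate n x := by
  induction n with
  | zero => rfl
  | succ n ih => rw [List.replicate_succ, profile, ih, List.replicate_succ']

theorem disp_replicate_U (n : ℕ) : disp (List.replicate n U) = 0 := by
  simp [disp, Letter.dx]

theorem disp_replicate_L (n : ℕ) : disp (List.replicate n L) = -n := by
  simp [disp, Letter.dx]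

theorem disp_replicate_R (n : ℕ) : disp (List.replicate n R) = n := by
  simp [disp, Letter.dx]

theorem disp_steps (x y : ℤ) : disp (steps x y) = y - x := by
  rw [steps, disp_append, disp_replicate_R, disp_replicate_L]
  omega

theorem profile_steps (z x y : ℤ) : profile z (steps x y) = [] := by
  rw [steps, profile_append, profile_replicate_R, profile_replicate_L, List.append_nil]

theorem disp_rowsWord (μ : List ℤ) : disp (rowsWord μ) = μ.headD 0 := by
  induction μ with
  | nil => rfl
  | cons a μ ih =>
    rw [rowsWord, disp_append, disp_append, ih, disp_steps]
    simp [disp, Letter.dx]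

theorem profile_rowsWord (μ : List ℤ) : profile 0 (rowsWord μ) = μ := by
  induction μ with
  | nil => rfl
  | cons a μ ih =>
    rw [rowsWord, profile_append, profile_append, ih, profile_steps, disp_append, disp_steps,
      disp_rowsWord]
    simp [profile]

/-! ### Windows of doubly infinite words -/

/-- The finite subword of length `n` starting at position `lo`. -/
def window (a : ℤ → Letter) (lo : ℤ) (n : ℕ) : List Letter :=
  (List.range n).map fun i : ℕ => a (lo + (i : ℤ))

/-- The finite word `βₙ ⋯ β₂ β₁`. -/
def revWord (β : ℕ → Letter) (n : ℕ) : List Letter := ((List.range n).map β).reverse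

/-- The finite word `γ₁ γ₂ ⋯ γₙ`. -/
def fwdWord (γ : ℕ → Letter) (n : ℕ) : List Letter := (List.range n).map γ

theorem length_revWord (β : ℕ → Letter) (n : ℕ) : (revWord β n).length = n := by simp [revWord]

theorem window_splice (β γ : ℕ → Letter) (w : List Letter) (p q : ℕ) :
    window (splice β w γ) (-p) (p + w.length + q) = revWord β p ++ w ++ fwdWord γ q := by
  refine List.ext_getElem (by simp [window, revWord, fwdWord, add_assoc]) fun i h1 h2 => ?_
  simp only [window, List.getElem_map, List.getElem_range, splice]
  simp only [List.getElem_append, length_revWord, List.length_append]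
  split_ifs with h3 h4 h5 h5 h4
  any_goals omega
  · simp only [revWord, List.getElem_reverse, List.getElem_map, List.getElem_range,
      List.length_map, List.length_range]
    congr 1
    omega
  · have h6 : (-(p : ℤ) + i).toNat = i - p := by omega
    rw [h6, List.getD_eq_getElem _ _ (by omega)]
  · have h6 : (-(p : ℤ) + i).toNat = i - p := by omega
    rw [h6, List.getD_eq_default _ _ (by omega)]
    simp only [fwdWord, List.getElem_map, List.getElem_range]
    congr 1
    omega

theorem sameWord_window {a : ℤ → Letter} {lo : ℤ} {n : ℕ} (hlo : ∀ i, i < lo → a i = U)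
    (hhi : ∀ i, lo + n ≤ i → a i = R) :
    SameWord a (splice (fun _ => U) (window a lo n) (fun _ => R)) := by
  refine ⟨lo, fun i => ?_⟩
  rw [splice]
  split_ifs with h
  · exact hlo _ (by omega)
  · rcases lt_or_ge i.toNat n with h1 | h1
    · rw [List.getD_eq_getElem _ _ (by simpa [window] using h1)]
      simp only [window, List.getElem_map, List.getElem_range]
      congr 1
      omega
    · rw [List.getD_eq_default _ _ (by simpa [window] using h1)]
      exact hhi _ (by omega)

theorem SameWord.symm {a b : ℤ → Letter} (h : SameWord a b) : SameWord b a := by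
  obtain ⟨s, hs⟩ := h
  exact ⟨-s, fun i => by rw [← hs, neg_add_cancel_right]⟩

theorem SameWord.trans {a b c : ℤ → Letter} (h : SameWord a b) (h' : SameWord b c) :
    SameWord a c := by
  obtain ⟨s, hs⟩ := h
  obtain ⟨t, ht⟩ := h'
  exact ⟨t + s, fun i => by rw [← ht, ← hs, add_assoc]⟩

theorem SameWord.refl (a : ℤ → Letter) : SameWord a a := ⟨0, fun i => by rw [add_zero]⟩

theorem splice_eq_left {β γ : ℕ → Letter} {w : List Letter} {N : ℕ} (h : ∀ i, N ≤ i → β i = U)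
    {i : ℤ} (hi : i < -N) : splice β w γ i = U := by
  rw [splice, if_pos (by omega)]
  exact h _ (by omega)

theorem splice_eq_right {β γ : ℕ → Letter} {w : List Letter} {M : ℕ} (h : ∀ i, M ≤ i → γ i = R)
    {i : ℤ} (hi : w.length + M ≤ i) : splice β w γ i = R := by
  rw [splice, if_neg (by omega), List.getD_eq_default _ _ (by omega)]
  exact h _ (by omega)

theorem sameWord_splice {β γ : ℕ → Letter} (w : List Letter) {N M : ℕ}
    (hβ : ∀ i, N ≤ i → β i = U) (hγ : ∀ i, M ≤ i → γ i = R) :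
    SameWord (splice β w γ)
      (splice (fun _ => U) (revWord β N ++ w ++ fwdWord γ M) (fun _ => R)) := by
  rw [← window_splice]
  refine sameWord_window (fun i hi => splice_eq_left hβ hi) fun i hi => splice_eq_right hγ ?_
  push_cast at hi
  omega

theorem revWord_const (c : Letter) (n : ℕ) : revWord (fun _ => c) n = List.replicate n c := by
  simp [revWord, List.map_const']

theorem fwdWord_const (c : Letter) (n : ℕ) : fwdWord (fun _ => c) n = List.replicate n c := by
  simp [fwdWord, List.map_const']

theorem window_eq_of_shift {a b : ℤ → Letter} {s : ℤ} (h : ∀ i, a (i + s) = b i) (lo : ℤ)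
    (n : ℕ) : window b lo n = window a (lo + s) n := by
  unfold window
  refine List.map_congr_left fun i _ => ?_
  rw [← h]
  congr 1
  ring

/-- A splice with the code of a composition has finite windows that contain all rows. -/
theorem exists_window_eq {μ : List ℤ} {β γ : ℕ → Letter} {w : List Letter}
    (h : SameWord (code μ) (splice β w γ)) (N₀ : ℕ) :
    ∃ N, N₀ ≤ N ∧ ∃ M p q : ℕ, (∀ i, N ≤ i → β i = U) ∧ (∀ i, M ≤ i → γ i = R) ∧
      revWord β N ++ w ++ fwdWord γ M =
        List.replicate p U ++ rowsWord μ ++ List.replicate q R := by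
  obtain ⟨s, hs⟩ := h
  refine ⟨N₀ + s.natAbs, by omega, (rowsWord μ).length + s.natAbs, (N₀ + s.natAbs - s).toNat,
    (s + w.length + s.natAbs).toNat, fun i hi => ?_, fun i hi => ?_, ?_⟩
  · have h1 := hs (-i - 1)
    rw [code, splice_eq_left (N := 0) (fun _ _ => rfl) (by omega), splice, if_pos (by omega)] at h1
    rw [h1]
    congr 1
    omega
  · have h1 := hs (w.length + i)
    rw [code, splice_eq_right (M := 0) (fun _ _ => rfl) (by omega), splice, if_neg (by omega),
      List.getD_eq_default _ _ (by omega)] at h1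
    rw [h1]
    congr 1
    omega
  · rw [← window_splice, window_eq_of_shift hs, ← revWord_const, ← fwdWord_const, ← window_splice,
      code]
    congr 1 <;> omega

/-! ### An invariant of cancellation -/

/-- The sequence of abscissae of the steps up, from the last to the first, is `P`. -/
def HasProfile (a : ℤ → Letter) (P : ℕ → ℤ) : Prop :=
  ∃ lo₀ hi₀ : ℤ, ∀ lo hi : ℤ, lo ≤ lo₀ → hi₀ ≤ hi →
    ∀ t, (profile 0 (window a lo (hi - lo).toNat)).getD t 0 = P t

theorem HasProfile.unique {a : ℤ → Letter} {P Q : ℕ → ℤ} (hP : HasProfile a P)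
    (hQ : HasProfile a Q) : P = Q := by
  obtain ⟨l, h, H⟩ := hP
  obtain ⟨l', h', H'⟩ := hQ
  funext t
  rw [← H (min l l') (max h h') (min_le_left _ _) (le_max_left _ _),
    H' (min l l') (max h h') (min_le_right _ _) (le_max_right _ _)]

theorem HasProfile.of_sameWord {a b : ℤ → Letter} {P : ℕ → ℤ} (hP : HasProfile a P)
    (h : SameWord a b) : HasProfile b P := by
  obtain ⟨l, r, H⟩ := hP
  obtain ⟨s, hs⟩ := h
  refine ⟨l - s, r - s, fun lo hi h1 h2 t => ?_⟩
  rw [window_eq_of_shift hs, ← H (lo + s) (hi + s) (by omega) (by omega)]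
  congr 4
  omega

/-- A cancelled pair contains no `U` and has displacement zero, so a window and the one with the
pair reinserted, two letters longer, have equal profiles. -/
theorem HasProfile.of_cancel {a b : ℤ → Letter} {P : ℕ → ℤ} (hP : HasProfile a P)
    (h : Cancel a b) : HasProfile b P := by
  obtain ⟨β, c, γ, hc, ha, hb⟩ := h
  refine HasProfile.of_sameWord ?_ hb.symm
  obtain ⟨l, r, H⟩ := hP.of_sameWord ha
  refine ⟨min l 0, max r 0, fun lo hi h1 h2 t => ?_⟩
  have hc2 : c.length = 2 := by rcases hc with rfl | rfl <;> rfl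
  obtain ⟨p, rfl⟩ : ∃ p : ℕ, lo = -p := ⟨(-lo).toNat, by omega⟩
  obtain ⟨q, rfl⟩ : ∃ q : ℕ, hi = q := ⟨hi.toNat, by omega⟩
  rw [← H (-p) (q + 2) (by omega) (by omega)]
  have e1 : ((q : ℤ) - -p).toNat = p + ([] : List Letter).length + q := by simp; omega
  have e2 : ((q : ℤ) + 2 - -p).toNat = p + c.length + q := by omega
  rw [e1, e2, window_splice, window_splice, profile_append, profile_append, profile_append,
    profile_append, disp_append, disp_append]
  rcases hc with rfl | rfl <;> simp [disp, profile, Letter.dx]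

theorem HasProfile.of_reduces {a b : ℤ → Letter} {P : ℕ → ℤ} (hP : HasProfile a P)
    (h : Relation.ReflTransGen Cancel a b) : HasProfile b P := by
  induction h with
  | refl => exact hP
  | tail _ hc ih => exact ih.of_cancel hc

theorem getD_replicate_self {α : Type*} (x : α) (n i : ℕ) : (List.replicate n x).getD i x = x := by
  rw [List.getD_eq_getElem?_getD, List.getElem?_replicate]
  split_ifs <;> rfl

/-- Widening the window to the left only appends zeros to the profile, which agree with the default
value of `getD`. -/
theorem hasProfile_splice (w : List Letter) :
    HasProfile (splice (fun _ => U) w (fun _ => R)) fun t => (profile 0 w).getD t 0 := by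
  refine ⟨0, w.length, fun lo hi h1 h2 t => ?_⟩
  obtain ⟨p, rfl⟩ : ∃ p : ℕ, lo = -p := ⟨(-lo).toNat, by omega⟩
  obtain ⟨q, rfl⟩ : ∃ q : ℕ, hi = w.length + q := ⟨(hi - w.length).toNat, by omega⟩
  have e1 : ((w.length : ℤ) + q - -p).toNat = p + w.length + q := by omega
  rw [e1, window_splice, revWord_const, fwdWord_const, profile_append, profile_append,
    profile_replicate_R, profile_replicate_U, disp_replicate_U, zero_add, List.nil_append]
  rcases lt_or_ge t (profile 0 w).length with h | h
  · rw [List.getD_append _ _ _ _ h]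
  · refine Eq.trans ?_ (List.getD_eq_default _ _ h).symm
    rw [List.getD_append_right _ _ _ _ h]
    exact getD_replicate_self 0 _ _

/-- The word determines the composition up to trailing zeros, hence completely once its length is
fixed. -/
theorem HasCode.getD_eq {ν : List ℤ} {a : ℤ → Letter} (h : HasCode ν a) {w : List Letter}
    (ha : SameWord a (splice (fun _ => U) w (fun _ => R))) (t : ℕ) :
    ν.getD t 0 = (profile 0 w).getD t 0 := by
  obtain ⟨b, hab, hb⟩ := h
  have h1 := (hasProfile_splice w).of_sameWord ha.symm
  have h2 := h1.of_reduces hab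
  have h3 := hasProfile_splice (rowsWord ν)
  rw [profile_rowsWord] at h3
  exact congrFun (h3.unique (h2.of_sameWord hb)) t

/-! ### Reduction of words to codes -/

/-- Cancellation of two adjacent letters in a finite word. -/
def CancelList (w w' : List Letter) : Prop :=
  ∃ u c v : List Letter, (c = [L, R] ∨ c = [R, L]) ∧ w = u ++ c ++ v ∧ w' = u ++ v

theorem CancelList.append {w w' : List Letter} (h : CancelList w w') (y z : List Letter) :
    CancelList (y ++ w ++ z) (y ++ w' ++ z) := by
  obtain ⟨u, c, v, hc, rfl, rfl⟩ := h
  exact ⟨y ++ u, c, v ++ z, hc, by simp, by simp⟩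

theorem sameWord_splice_cons (β γ : ℕ → Letter) (c : Letter) (w : List Letter) :
    SameWord (splice β (c :: w) γ) (splice (fun i => Nat.casesOn i c β) w γ) := by
  refine ⟨1, fun i => ?_⟩
  rcases lt_trichotomy i (-1) with h | rfl | h
  · rw [splice, splice, if_pos (by omega), if_pos (by omega)]
    have : (-i - 1).toNat = (-(i + 1) - 1).toNat + 1 := by omega
    rw [this]
  · simp [splice]
  · rw [splice, splice, if_neg (by omega), if_neg (by omega)]
    have : (i + 1).toNat = i.toNat + 1 := by omega
    simp [this]

theorem exists_sameWord_splice_append (u : List Letter) (β : ℕ → Letter) :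
    ∃ β' : ℕ → Letter, ∀ w γ, SameWord (splice β (u ++ w) γ) (splice β' w γ) := by
  induction u generalizing β with
  | nil => exact ⟨β, fun w γ => SameWord.refl _⟩
  | cons c u ih =>
    obtain ⟨β', h⟩ := ih fun i => Nat.casesOn i c β
    exact ⟨β', fun w γ => (sameWord_splice_cons β γ c (u ++ w)).trans (h w γ)⟩

theorem splice_append (β γ : ℕ → Letter) (w v : List Letter) :
    splice β (w ++ v) γ = splice β w fun i => v.getD i (γ (i - v.length)) := by
  funext i
  unfold splice
  split_ifs with h
  · rfl
  · rcases lt_or_ge i.toNat w.length with h1 | h1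
    · rw [List.getD_append _ _ _ _ h1, List.getD_eq_getElem _ _ h1, List.getD_eq_getElem _ _ h1]
    · rw [List.getD_append_right _ _ _ _ h1, List.getD_eq_default w _ h1, List.length_append,
        Nat.sub_add_eq]

theorem CancelList.cancel {w w' : List Letter} (h : CancelList w w') (β γ : ℕ → Letter) :
    Cancel (splice β w γ) (splice β w' γ) := by
  obtain ⟨u, c, v, hc, rfl, rfl⟩ := h
  obtain ⟨β', h⟩ := exists_sameWord_splice_append u β
  refine ⟨β', c, fun i => v.getD i (γ (i - v.length)), hc, ?_, ?_⟩
  · rw [splice_append]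
    exact h c _
  · rw [splice_append]
    simpa using h [] _

theorem reduces_steps_append_R (x y : ℤ) :
    Relation.ReflTransGen CancelList (steps x y ++ [R]) (steps x (y + 1)) := by
  rcases le_or_gt x y with h | h
  · have e : (y + 1 - x).toNat = (y - x).toNat + 1 := by omega
    have e1 : (x - y).toNat = 0 := by omega
    have e2 : (x - (y + 1)).toNat = 0 := by omega
    rw [steps, steps, e, e1, e2, List.replicate_succ']
    simpa using Relation.ReflTransGen.refl
  · have e : (x - y).toNat = (x - (y + 1)).toNat + 1 := by omega
    have e1 : (y - x).toNat = 0 := by omega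
    have e2 : (y + 1 - x).toNat = 0 := by omega
    refine Relation.ReflTransGen.single
      ⟨List.replicate (x - (y + 1)).toNat L, [L, R], [], Or.inl rfl, ?_, ?_⟩
    · rw [steps, e, e1, List.replicate_succ']; simp
    · rw [steps, e2]; simp

theorem reduces_steps_append_L (x y : ℤ) :
    Relation.ReflTransGen CancelList (steps x y ++ [L]) (steps x (y - 1)) := by
  rcases le_or_gt y x with h | h
  · have e : (x - (y - 1)).toNat = (x - y).toNat + 1 := by omega
    have e1 : (y - x).toNat = 0 := by omega
    have e2 : (y - 1 - x).toNat = 0 := by omega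
    rw [steps, steps, e, e1, e2, List.replicate_succ']
    simpa using Relation.ReflTransGen.refl
  · have e : (y - x).toNat = (y - 1 - x).toNat + 1 := by omega
    have e1 : (x - y).toNat = 0 := by omega
    have e2 : (x - (y - 1)).toNat = 0 := by omega
    refine Relation.ReflTransGen.single
      ⟨List.replicate (y - 1 - x).toNat R, [R, L], [], Or.inr rfl, ?_, ?_⟩
    · rw [steps, e, e1, List.replicate_succ']; simp
    · rw [steps, e2]; simp

theorem reduces_append {w w' : List Letter} (h : Relation.ReflTransGen CancelList w w')
    (y z : List Letter) : Relation.ReflTransGen CancelList (y ++ w ++ z) (y ++ w' ++ z) :=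
  h.lift (fun w => y ++ w ++ z) fun _ _ h => h.append y z

/-- Induction on the last letter: a horizontal letter prolongs or shortens the final run, and a `U`
turns this run into a new top row. -/
theorem reduces_rowsWord (w : List Letter) :
    Relation.ReflTransGen CancelList w
      (rowsWord (profile 0 w) ++ steps ((profile 0 w).headD 0) (disp w)) := by
  induction w using List.reverseRecOn with
  | nil => exact Relation.ReflTransGen.refl
  | append_singleton w c ih =>
    have h1 := reduces_append ih [] [c]
    rw [List.nil_append, List.nil_append, List.append_assoc] at h1
    refine h1.trans ?_
    rw [profile_append, zero_add, disp_append]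
    cases c with
    | R => simpa [profile, disp, Letter.dx] using
        reduces_append (reduces_steps_append_R _ _) (rowsWord (profile 0 w)) []
    | L => simpa [profile, disp, Letter.dx, sub_eq_add_neg] using
        reduces_append (reduces_steps_append_L _ _) (rowsWord (profile 0 w)) []
    | U =>
      have e : steps (disp w) (disp w) = [] := by simp [steps]
      have e2 : disp [U] = 0 := rfl
      simp only [profile, List.nil_append, List.singleton_append, rowsWord, List.headD_cons, e2,
        add_zero, e, List.append_nil, List.append_assoc]
      exact Relation.ReflTransGen.refl

theorem splice_append_replicate_R (β : ℕ → Letter) (w : List Letter) (n : ℕ) :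
    splice β (w ++ List.replicate n R) (fun _ => R) = splice β w fun _ => R := by
  rw [splice_append]
  congr 1
  funext i
  exact getD_replicate_self R n i

theorem hasCode_splice (w : List Letter) :
    HasCode (profile 0 w) (splice (fun _ => U) w fun _ => R) := by
  -- Enough letters `R` are borrowed from the infinite tail for the final run to contain no `L`; the
  -- tail then absorbs that run.
  set n := ((profile 0 w).headD 0 - disp w).toNat with hn
  have h1 := reduces_rowsWord (w ++ List.replicate n R)
  rw [profile_append, profile_replicate_R, List.nil_append, disp_append, disp_replicate_R] at h1
  have e : steps ((profile 0 w).headD 0) (disp w + n) =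
      List.replicate (disp w + n - (profile 0 w).headD 0).toNat R := by
    have : ((profile 0 w).headD 0 - (disp w + n)).toNat = 0 := by omega
    rw [steps, this]; simp
  rw [e] at h1
  have h2 := h1.lift (fun w => splice (fun _ => U) w fun _ => R) fun _ _ h => h.cancel _ _
  simp only [Function.onFun, splice_append_replicate_R] at h2
  exact ⟨_, h2, SameWord.refl _⟩

theorem Cancel.of_sameWord {a a' b : ℤ → Letter} (h : SameWord a a') (hc : Cancel a' b) :
    Cancel a b := by
  obtain ⟨β, c, γ, hc, ha, hb⟩ := hc
  exact ⟨β, c, γ, hc, h.trans ha, hb⟩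

theorem HasCode.of_sameWord {ν : List ℤ} {a a' : ℤ → Letter} (h : SameWord a a')
    (hc : HasCode ν a') : HasCode ν a := by
  obtain ⟨b, hab, hb⟩ := hc
  rcases Relation.ReflTransGen.cases_head hab with rfl | ⟨c, h1, h2⟩
  · exact ⟨a, Relation.ReflTransGen.refl, h.trans hb⟩
  · exact ⟨b, Relation.ReflTransGen.head (h1.of_sameWord h) h2, hb⟩

theorem rowsWord_append_replicate_zero (ν : List ℤ) (p : ℕ) :
    rowsWord (ν ++ List.replicate p 0) = List.replicate p U ++ rowsWord ν := by
  have h (p : ℕ) : (List.replicate p (0 : ℤ)).headD 0 = 0 := by cases p <;> rfl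
  induction ν with
  | nil =>
    induction p with
    | zero => rfl
    | succ p ih =>
      rw [List.nil_append] at ih ⊢
      have h1 : rowsWord (0 :: List.replicate p 0) =
        rowsWord (List.replicate p 0) ++ steps ((List.replicate p 0).headD 0) 0 ++ [U] := rfl
      rw [List.replicate_succ, h1, ih, h, List.replicate_succ']
      simp [steps, rowsWord]
  | cons a ν ih =>
    have h2 : (ν ++ List.replicate p 0).headD 0 = ν.headD 0 := by
      cases ν with
      | nil => exact h p
      | cons => rfl
    rw [List.cons_append, rowsWord, ih, h2, rowsWord]
    simp

theorem HasCode.of_append_replicate_zero {ν : List ℤ} {p : ℕ} {a : ℤ → Letter}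
    (h : HasCode (ν ++ List.replicate p 0) a) : HasCode ν a := by
  obtain ⟨b, hab, hb⟩ := h
  refine ⟨b, hab, hb.trans ?_⟩
  have h1 := sameWord_splice (β := fun _ => U) (γ := fun _ => R) (rowsWord ν) (N := p) (M := 0)
    (fun _ _ => rfl) (fun _ _ => rfl)
  rw [code, rowsWord_append_replicate_zero]
  simpa [revWord_const, fwdWord_const, code] using h1.symm

end QCode

namespace QCode

open Letter

/-! ### Moving a row -/

theorem revWord_succ (β : ℕ → Letter) (n : ℕ) : revWord β (n + 1) = β n :: revWord β n := by
  simp [revWord, List.range_succ]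

theorem revWord_add (β : ℕ → Letter) (n m : ℕ) :
    revWord β (n + m) = revWord (fun i => β (n + i)) m ++ revWord β n := by
  induction m with
  | zero => simp [revWord]
  | succ m ih => rw [← add_assoc, revWord_succ, ih, revWord_succ, List.cons_append]

theorem countR_succ (β : ℕ → Letter) (n : ℕ) :
    countR β (n + 1) = countR β n + if β n = R then 1 else 0 := by
  rw [countR, countR, Finset.range_add_one, Finset.filter_insert]
  split_ifs
  · rw [Finset.card_insert_of_notMem (by simp)]
  · rfl

theorem disp_revWord {β : ℕ → Letter} (hβ : ∀ i, β i = R ∨ β i = U) (n : ℕ) :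
    disp (revWord β n) = countR β n := by
  induction n with
  | zero => rfl
  | succ n ih =>
    have h : disp (revWord β (n + 1)) = (β n).dx + disp (revWord β n) := by
      rw [revWord_succ]; rfl
    rw [h, ih, countR_succ]
    rcases hβ n with h1 | h1 <;> simp [h1, Letter.dx, add_comm]

theorem length_profile_revWord {β : ℕ → Letter} (hβ : ∀ i, β i = R ∨ β i = U) (x : ℤ) (n : ℕ) :
    (profile x (revWord β n)).length + countR β n = n := by
  induction n generalizing x with
  | zero => rfl
  | succ n ih =>
    rw [revWord_succ, countR_succ]
    rcases hβ n with h1 | h1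
    · rw [h1, profile, if_pos rfl, ← add_assoc, ih]
    · rw [h1, profile, if_neg (by decide), List.length_append, List.length_singleton, add_zero,
        add_right_comm, ih]

theorem le_of_mem_profile_revWord {β : ℕ → Letter} (hβ : ∀ i, β i = R ∨ β i = U) {x a : ℤ} {n : ℕ}
    (ha : a ∈ profile x (revWord β n)) : x ≤ a := by
  induction n generalizing x with
  | zero => simp [revWord, profile] at ha
  | succ n ih =>
    rw [revWord_succ] at ha
    rcases hβ n with h1 | h1
    · rw [h1, profile] at ha
      have := ih ha
      omega
    · rw [h1, profile, List.mem_append, List.mem_singleton] at ha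
      rcases ha with ha | rfl
      · exact ih ha
      · exact le_rfl

theorem disp_revWord_pos {β : ℕ → Letter} (hβ : ∀ i, β i = R ∨ β i = U) {i n : ℕ} (hi : i < n)
    (h : β i = R) : 0 < disp (revWord β n) := by
  rw [disp_revWord hβ, Nat.cast_pos, countR, Finset.card_pos]
  exact ⟨i, Finset.mem_filter.2 ⟨Finset.mem_range.2 hi, h⟩⟩

/-- The last entry of `E` is positive, so it cannot lie in the zero padding; the padding is
therefore a tail of `C`. -/
theorem exists_append_of_append_replicate_zero {μ G E C : List ℤ} {p : ℕ} (hE : ∀ a ∈ E, 0 < a)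
    (hE0 : E ≠ []) (h : μ ++ List.replicate p 0 = (G ++ E) ++ C) :
    ∃ C', μ = (G ++ E) ++ C' ∧ C = C' ++ List.replicate p 0 := by
  rcases List.append_eq_append_iff.1 h with ⟨a, h1, h2⟩ | h1
  · rcases List.eq_nil_or_concat a with rfl | ⟨a', z, rfl⟩
    · exact ⟨[], by simpa using h1.symm, by simpa using h2.symm⟩
    · have hz : z = 0 := by
        have : z ∈ List.replicate p (0 : ℤ) := by rw [h2]; simp
        exact List.eq_of_mem_replicate this
      obtain ⟨E', y, rfl⟩ := (List.eq_nil_or_concat E).resolve_left hE0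
      have h3 : y = z := by
        have h4 : (G ++ E') ++ [y] = (μ ++ a') ++ [z] := by simpa using h1
        exact List.singleton_inj.1 (List.append_inj_right' h4 rfl)
      have := hE y (by simp)
      omega
  · exact h1

theorem profile_window (B B' Γ : List Letter) (k : ℕ) (hB : disp B = k) :
    profile 0 (B' ++ B ++ (List.replicate k L ++ [U]) ++ Γ) =
      profile (disp B') Γ ++ disp B' :: (profile (disp B') B ++ profile 0 B') := by
  simp [profile_append, hB, disp_replicate_L, profile_replicate_L, profile]

theorem profile_insertedWindow (B B' Γ : List Letter) (k : ℕ) (hB : disp B = k) :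
    profile 0 (B' ++ (U :: B ++ List.replicate k L) ++ Γ) =
      profile (disp B') Γ ++ (profile (disp B') B ++ disp B' :: profile 0 B') := by
  simp [profile_append, hB, disp_replicate_L, profile_replicate_L, profile]

/-- The rows of a composition around the row that is moved, together with the code of the result
of the move. -/
theorem exists_rows {μ : List ℤ} {β γ : ℕ → Letter} {k n : ℕ}
    (hcode : SameWord (code μ) (splice β (List.replicate k L ++ [U]) γ))
    (hβ : ∀ i, β i = R ∨ β i = U) (hn : countR β n = k) (m₀ : ℕ) :
    ∃ m p : ℕ, ∃ G : List ℤ, m₀ ≤ m ∧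
      μ ++ List.replicate p 0 =
        G ++ disp (revWord (fun i => β (n + i)) m) ::
          (profile (disp (revWord (fun i => β (n + i)) m)) (revWord β n) ++
            profile 0 (revWord (fun i => β (n + i)) m)) ∧
      ∃ w : List Letter,
        SameWord (insertedWord β k n γ) (splice (fun _ => U) w fun _ => R) ∧
        profile 0 w = G ++ (profile (disp (revWord (fun i => β (n + i)) m)) (revWord β n) ++
          disp (revWord (fun i => β (n + i)) m) ::
            profile 0 (revWord (fun i => β (n + i)) m)) := by
  obtain ⟨N, hN, M, p, q, h1, h2, h3⟩ := exists_window_eq hcode (n + m₀)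
  obtain ⟨m, rfl⟩ := Nat.exists_eq_add_of_le (le_of_add_le_left hN)
  have hk : disp (revWord β n) = k := by rw [disp_revWord hβ, hn]
  refine ⟨m, p, _, by omega, ?_, _, sameWord_splice _ (fun i (hi : m ≤ i) => h1 _ (by omega)) h2,
    profile_insertedWindow _ _ _ _ hk⟩
  rw [revWord_add] at h3
  rw [← profile_window _ _ _ _ hk, h3, profile_append, profile_append, profile_replicate_R,
    profile_replicate_U, disp_replicate_U, zero_add, profile_rowsWord, List.nil_append]

theorem YNeg_eq_zero_of_code {μ : List ℤ} {β γ : ℕ → Letter} {k n : ℕ}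
    (hcode : SameWord (code μ) (splice β (List.replicate k L ++ [U]) γ))
    (hβ : ∀ i, β i = R ∨ β i = U) (hn : countR β n = k) (hU : β n = U)
    (hR : ∃ i, n < i ∧ β i = R) : YNeg μ = 0 := by
  obtain ⟨i, hi, hiR⟩ := hR
  -- The bound `i + 1` makes the window contain the letter `β i = R`, which forces the abscissa of
  -- the moved row to be positive.
  obtain ⟨m, p, G, hm, hμ, -⟩ := exists_rows hcode hβ hn (i + 1)
  obtain ⟨m, rfl⟩ : ∃ m', m = 1 + m' := ⟨m - 1, by omega⟩
  have hx : 0 < disp (revWord (fun i => β (n + i)) (1 + m)) :=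
    disp_revWord_pos (fun i => hβ _) (i := i - n) (by omega)
      (by rw [Nat.add_sub_cancel' hi.le, hiR])
  have hC : ∃ C, profile 0 (revWord (fun i => β (n + i)) (1 + m)) =
      disp (revWord (fun i => β (n + i)) (1 + m)) :: C := by
    have h1 : revWord (fun i => β (n + i)) 1 = [U] := by rw [revWord_succ]; simp [revWord, hU]
    have h2 : disp [U] = 0 := rfl
    rw [revWord_add, h1, profile_append, disp_append, h2, zero_add, add_zero]
    exact ⟨_, rfl⟩
  set x := disp (revWord (fun i => β (n + i)) (1 + m))
  obtain ⟨C, hC⟩ := hC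
  have hA : ∀ a ∈ profile x (revWord β n), 0 < a := fun a ha =>
    hx.trans_le (le_of_mem_profile_revWord hβ ha)
  rw [hC] at hμ
  obtain ⟨C', rfl, -⟩ := exists_append_of_append_replicate_zero
    (E := x :: (profile x (revWord β n) ++ [x])) (G := G) (C := C) (μ := μ) (p := p)
    (by simpa [or_imp, forall_and, hx] using hA) (by simp) (by simpa using hμ)
  simpa using YNeg_eq_zero_of_repeated hx G hA C'

theorem exists_moved_of_code {μ : List ℤ} {β γ : ℕ → Letter} {k j : ℕ}
    (hcode : SameWord (code μ) (splice β (List.replicate k L ++ [U]) γ))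
    (hβ : ∀ i, β i = R ∨ β i = U) (hn : countR β (k + j) = k) (hR : β (k + j) = R) :
    ∃ ν : List ℤ, ν.length = μ.length ∧ HasCode ν (insertedWord β k (k + j) γ) ∧
      (∀ ν' : List ℤ, ν'.length = μ.length → HasCode ν' (insertedWord β k (k + j) γ) → ν' = ν) ∧
      ν.sum = μ.sum ∧ ((∀ a ∈ μ, 0 < a) → ∀ a ∈ ν, 0 < a) ∧
      YNeg μ = (-1 : ℂ) ^ j • YNeg ν := by
  obtain ⟨m, p, G, hm, hμ, w, hw, hpw⟩ := exists_rows hcode hβ hn 1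
  have hx : 0 < disp (revWord (fun i => β (k + j + i)) m) :=
    disp_revWord_pos (fun i => hβ _) (i := 0) (by omega) (by rw [add_zero, hR])
  set x := disp (revWord (fun i => β (k + j + i)) m)
  have hlen := length_profile_revWord hβ x (k + j)
  have hA : ∀ a ∈ profile x (revWord β (k + j)), 0 < a := fun a ha =>
    hx.trans_le (le_of_mem_profile_revWord hβ ha)
  set A := profile x (revWord β (k + j))
  -- Of the `k + j` letters exactly `k` are `R`, so `j` rows are passed.
  have hAj : A.length = j := by omega
  obtain ⟨C, rfl, hC⟩ := exists_append_of_append_replicate_zero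
    (E := x :: A) (G := G) (μ := μ) (p := p)
    (by simpa [or_imp, forall_and, hx] using hA) (by simp)
    (by rw [hμ, List.append_assoc, List.cons_append])
  have hlen' : (G ++ (A ++ x :: C)).length = (G ++ x :: A ++ C).length := by
    simp only [List.length_append, List.length_cons]; omega
  have hpw' : profile 0 w = (G ++ (A ++ x :: C)) ++ List.replicate p 0 := by
    rw [hpw, hC]; simp
  have hcodeν : HasCode (G ++ (A ++ x :: C)) (insertedWord β k (k + j) γ) := by
    refine HasCode.of_append_replicate_zero (p := p) ?_
    rw [← hpw']
    exact (hasCode_splice w).of_sameWord hw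
  refine ⟨G ++ (A ++ x :: C), hlen', hcodeν, fun ν' h1 h2 => ?_, ?_, fun h a ha => h a ?_, ?_⟩
  · refine List.ext_getElem (h1.trans hlen'.symm) fun t ht ht' => ?_
    rw [← List.getD_eq_getElem _ 0 ht, ← List.getD_eq_getElem _ 0 ht', h2.getD_eq hw,
      hcodeν.getD_eq hw]
  · simp only [List.sum_append, List.sum_cons]; ring
  · simp only [List.mem_append, List.mem_cons] at ha ⊢
    tauto
  · rw [List.append_assoc, List.cons_append, YNeg_move hx G hA C, hAj]

end QCode

theorem theorem6p3 (m : ℤ) (μ : List ℤ) (hm : μ.sum = m)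
    (β γ : ℕ → QCode.Letter) (k j : ℕ)
    (hcode : QCode.SameWord (QCode.code μ)
      (QCode.splice β (List.replicate k QCode.Letter.L ++ [QCode.Letter.U]) γ))
    (hβ : ∀ i, β i = QCode.Letter.R ∨ β i = QCode.Letter.U)
    (hβ1 : β 0 = QCode.Letter.U)
    (hj : IsLeast {j : ℕ | QCode.countR β (k + j) = k} j) :
    (β (k + j) = QCode.Letter.U → (∃ i, k + j < i ∧ β i = QCode.Letter.R) →
      QCode.YNeg μ = 0) ∧
    (β (k + j) = QCode.Letter.R →
      (∃! ν : List ℤ, ν.length = μ.length ∧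
        QCode.HasCode ν (QCode.insertedWord β k (k + j) γ)) ∧
      ∀ ν : List ℤ, ν.length = μ.length →
        QCode.HasCode ν (QCode.insertedWord β k (k + j) γ) →
        ν.sum = m ∧ ((∀ a ∈ μ, 0 < a) → ∀ a ∈ ν, 0 < a) ∧
        QCode.YNeg μ = (-1 : ℂ) ^ j • QCode.YNeg ν) := by
  refine ⟨QCode.YNeg_eq_zero_of_code hcode hβ hj.1, fun hR => ?_⟩
  obtain ⟨ν, h1, h2, h3, h4, h5, h6⟩ := QCode.exists_moved_of_code hcode hβ hj.1 hR
  refine ⟨⟨ν, ⟨h1, h2⟩, fun ν' h => h3 ν' h.1 h.2⟩, fun ν' h1' h2' => ?_⟩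
  rw [h3 ν' h1' h2']
  exact ⟨h4.trans hm, h5, h6⟩
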